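/- Let $n\ge 2$, and let $\mathrm{SU}(n,1)$ be the group of complex $(n+1)\times(n+1)$ matrices of determinant $1$ that preserve the Hermitian form $\langle z,w\rangle=w^{*}\,\mathrm{diag}(-1,1,\dots,1)\,z$ of signature $(n,1)$ on $\mathbb{C}^{n+1}$. A pair $(g_1,g_2)$ of elements of a group $G$ is called strongly doubly reversible if there is $h\in G$ with $h^2=1$ such that $hg_1h^{-1}=g_1^{-1}$ and $hg_2h^{-1}=g_2^{-1}$. Then the set of strongly doubly reversible pairs in $G=\mathrm{SU}(n,1)$ has Haar measure zero in $\mathrm{SU}(n,1)\times\mathrm{SU}(n,1)$. -/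

import Mathlib

open scoped Matrix
open MeasureTheory

/-- A pair `(g₁, g₂)` of elements of a group `G` is strongly doubly reversible if it is conjugate to
`(g₁⁻¹, g₂⁻¹)` under simultaneous conjugation by some `h : G` with `h ^ 2 = 1`. -/
def StronglyDoublyReversible {G : Type*} [Group G] (g₁ g₂ : G) : Prop :=
  ∃ h : G, h ^ 2 = 1 ∧ h * g₁ * h⁻¹ = g₁⁻¹ ∧ h * g₂ * h⁻¹ = g₂⁻¹

/-- The Gram matrix `diag(-1, 1, …, 1)` of size `n + 1` of the standard Hermitian form of
signature `(n, 1)` on `ℂ^(n+1)`, namely `⟨z, w⟩ = wᴴ * lorentzForm n * z`. -/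
def lorentzForm (n : ℕ) : Matrix (Fin (n + 1)) (Fin (n + 1)) ℂ :=
  Matrix.diagonal fun i => if i = 0 then -1 else 1

/-- The group `SU(n,1)` of complex `(n+1) × (n+1)` matrices of determinant one preserving the
Hermitian form of signature `(n, 1)`. As a subgroup of `SL(n+1, ℂ)` it carries the topology induced
from the space of matrices. -/
def SUn1 (n : ℕ) : Subgroup (Matrix.SpecialLinearGroup (Fin (n + 1)) ℂ) where
  carrier := {A | (A : Matrix (Fin (n + 1)) (Fin (n + 1)) ℂ)ᴴ * lorentzForm n *
    (A : Matrix (Fin (n + 1)) (Fin (n + 1)) ℂ) = lorentzForm n}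
  one_mem' := by simp
  mul_mem' := by
    intro A B hA hB
    simp only [Set.mem_ofPred_eq, Matrix.SpecialLinearGroup.coe_mul,
      Matrix.conjTranspose_mul] at *
    calc _ = (B : Matrix (Fin (n + 1)) (Fin (n + 1)) ℂ)ᴴ *
          ((A : Matrix (Fin (n + 1)) (Fin (n + 1)) ℂ)ᴴ * lorentzForm n * A) * B := by
            simp only [Matrix.mul_assoc]
      _ = _ := by rw [hA, hB]
  inv_mem' := by
    intro A hA
    simp only [Set.mem_ofPred_eq] at *
    have h : (A : Matrix (Fin (n + 1)) (Fin (n + 1)) ℂ) *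
        ((A⁻¹ : Matrix.SpecialLinearGroup (Fin (n + 1)) ℂ) :
          Matrix (Fin (n + 1)) (Fin (n + 1)) ℂ) = 1 := by
      rw [← Matrix.SpecialLinearGroup.coe_mul, mul_inv_cancel, Matrix.SpecialLinearGroup.coe_one]
    set B := ((A⁻¹ : Matrix.SpecialLinearGroup (Fin (n + 1)) ℂ) :
          Matrix (Fin (n + 1)) (Fin (n + 1)) ℂ)
    have h' := congrArg Matrix.conjTranspose h
    rw [Matrix.conjTranspose_mul, Matrix.conjTranspose_one] at h'
    calc _ = Bᴴ * ((A : Matrix (Fin (n + 1)) (Fin (n + 1)) ℂ)ᴴ * lorentzForm n * A) * B := by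
            rw [hA]
      _ = (Bᴴ * (A : Matrix (Fin (n + 1)) (Fin (n + 1)) ℂ)ᴴ) * lorentzForm n * (A * B) := by
            simp only [Matrix.mul_assoc]
      _ = _ := by rw [h', h, Matrix.one_mul, Matrix.mul_one]

/-- `SU(n,1)` carries its Borel `σ`-algebra. -/
noncomputable instance (n : ℕ) : MeasurableSpace (SUn1 n) := borel _

instance (n : ℕ) : BorelSpace (SUn1 n) := ⟨rfl⟩

/-- `SU(n,1)` is second countable, so that the product `σ`-algebra on `SU(n,1) × SU(n,1)` is the
Borel `σ`-algebra. -/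
instance (n : ℕ) : SecondCountableTopology (SUn1 n) := by
  have h : Topology.IsInducing
      (fun A : SUn1 n => ((A : Matrix.SpecialLinearGroup (Fin (n + 1)) ℂ) :
        Matrix (Fin (n + 1)) (Fin (n + 1)) ℂ)) :=
    Topology.IsInducing.subtypeVal.comp Topology.IsInducing.subtypeVal
  have : SecondCountableTopology (Matrix (Fin (n + 1)) (Fin (n + 1)) ℂ) :=
    inferInstanceAs (SecondCountableTopology (Fin (n + 1) → Fin (n + 1) → ℂ))
  exact h.secondCountableTopology

/-- `SU(n,1)` is locally compact, so that Haar measures exist. -/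
instance (n : ℕ) : LocallyCompactSpace (SUn1 n) := by
  have h : Topology.IsInducing
      (fun A : SUn1 n => ((A : Matrix.SpecialLinearGroup (Fin (n + 1)) ℂ) :
        Matrix (Fin (n + 1)) (Fin (n + 1)) ℂ)) :=
    Topology.IsInducing.subtypeVal.comp Topology.IsInducing.subtypeVal
  have hinj : Function.Injective
      (fun A : SUn1 n => ((A : Matrix.SpecialLinearGroup (Fin (n + 1)) ℂ) :
        Matrix (Fin (n + 1)) (Fin (n + 1)) ℂ)) :=
    Subtype.val_injective.comp Subtype.val_injective
  have hr : Set.range (fun A : SUn1 n => ((A : Matrix.SpecialLinearGroup (Fin (n + 1)) ℂ) :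
        Matrix (Fin (n + 1)) (Fin (n + 1)) ℂ)) =
      {M | M.det = 1} ∩ {M | Mᴴ * lorentzForm n * M = lorentzForm n} := by
    ext M
    constructor
    · rintro ⟨A, rfl⟩
      exact ⟨A.1.2, A.2⟩
    · rintro ⟨h1, h2⟩
      exact ⟨⟨⟨M, h1⟩, h2⟩, rfl⟩
  have : LocallyCompactSpace (Matrix (Fin (n + 1)) (Fin (n + 1)) ℂ) :=
    inferInstanceAs (LocallyCompactSpace (Fin (n + 1) → Fin (n + 1) → ℂ))
  refine Topology.IsClosedEmbedding.locallyCompactSpace ⟨⟨h, hinj⟩, ?_⟩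
  rw [hr]
  exact (isClosed_eq (by fun_prop) continuous_const).inter
    (isClosed_eq (by fun_prop) continuous_const)

/-!
In `SU(n,1)` one has `g⁻¹ = J gᴴ J` with `J = lorentzForm n`, so an element conjugate to its inverse
has real trace, and it suffices that `{g | Im (tr g) = 0}` is null. Multiplying `g` by
`diag(zⁿ, z⁻¹, …, z⁻¹)` with `|z| = 1` turns the trace into `zⁿ a + z⁻¹ b`, where `a = g₀₀` and `b`
is the sum of the other diagonal entries; here `a ≠ 0` because the first basis vector is negative.
For `n ≥ 2` this is real for only finitely many `z`, so each orbit of the circle meets the closed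
set `{g | Im (tr g) = 0}` in a null set of parameters, and by Fubini and left invariance the set
itself is null. For `n = 1` the two frequencies are opposite and every trace in `SU(1,1)` is real.
-/

theorem trace_eq_of_isConj {ι R : Type*} [Fintype ι] [DecidableEq ι] [CommSemiring R]
    {A B : Matrix ι ι R} (h : IsConj A B) : A.trace = B.trace := by
  obtain ⟨c, hc⟩ := h
  calc A.trace
    _ = ((c : Matrix ι ι R) * A * (↑c⁻¹ : Matrix ι ι R)).trace :=
      (Matrix.trace_units_conj c A).symm
    _ = B.trace := by rw [hc.eq, Units.mul_inv_cancel_right]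

open Polynomial ComplexConjugate in
/-- On the unit circle `conj (p z) = z⁻ᵈ q z`, where `q` is the reversal of the conjugate of `p` and
`d = p.natDegree`, so the points in question are roots of `X ^ d * p - q`. -/
theorem finite_setOf_norm_eq_one_and_im_eval_eq_zero {p : ℂ[X]} (hp : p.natDegree ≠ 0) :
    {z : ℂ | ‖z‖ = 1 ∧ (p.eval z).im = 0}.Finite := by
  let q : ℂ[X] := (p.map (starRingEnd ℂ)).reverse
  have hq : q.natDegree ≤ p.natDegree :=
    (reverse_natDegree_le _).trans natDegree_map_le
  have hne : X ^ p.natDegree * p - q ≠ 0 := by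
    intro h
    have hdeg : (X ^ p.natDegree * p).natDegree = p.natDegree + p.natDegree := by
      rw [natDegree_X_pow_mul _ (by rintro rfl; simp at hp)]
    rw [sub_eq_zero.mp h] at hdeg
    omega
  refine (finite_setOfPred_isRoot hne).subset ?_
  rintro z ⟨hz, him⟩
  have hzz : conj z * z = 1 := by rw [Complex.conj_mul', hz]; norm_num
  let _ : Invertible (conj z) := ⟨z, by rw [mul_comm, hzz], hzz⟩
  have hqz : q.eval z * conj z ^ p.natDegree = p.eval z := by
    have h := eval₂_reverse_mul_pow (RingHom.id ℂ) (conj z) (p.map (starRingEnd ℂ))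
    rw [natDegree_map] at h
    calc q.eval z * conj z ^ p.natDegree
      _ = (p.map (starRingEnd ℂ)).eval (conj z) := h
      _ = p.eval z := by rw [eval_map_apply, Complex.conj_eq_iff_im.mpr him]
  change (X ^ p.natDegree * p - q).eval z = 0
  rw [eval_sub, eval_mul, eval_pow, eval_X, ← hqz]
  calc z ^ p.natDegree * (q.eval z * conj z ^ p.natDegree) - q.eval z
    _ = q.eval z * (conj z * z) ^ p.natDegree - q.eval z := by ring
    _ = 0 := by rw [hzz]; simp

theorem measure_eq_zero_of_forall_measure_smul_mem_eq_zero {G X T : Type*} [SMul G X]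
    [MeasurableSpace G] [MeasurableSpace X] [MeasurableSpace T] [MeasurableSMul₂ G X]
    (μ : Measure X) [SMulInvariantMeasure G X μ] [SFinite μ] (ν : Measure T) [SFinite ν] [NeZero ν]
    {u : T → G} (hu : Measurable u) {E : Set X} (hE : MeasurableSet E)
    (h : ∀ x, ν {t | u t • x ∈ E} = 0) : μ E = 0 := by
  have hF : MeasurableSet {p : T × X | u p.1 • p.2 ∈ E} :=
    ((hu.comp measurable_fst).smul measurable_snd) hE
  have hνμ : (ν.prod μ) {p : T × X | u p.1 • p.2 ∈ E} = 0 := by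
    rw [Measure.prod_apply_symm hF]
    simp only [Set.preimage_ofPred_eq, h, lintegral_zero]
  obtain ⟨t, ht⟩ := (Measure.measure_ae_null_of_prod_null hνμ).exists
  exact (SMulInvariantMeasure.measure_preimage_smul (u t) hE).symm.trans ht

theorem lorentzForm_mul_self (n : ℕ) : lorentzForm n * lorentzForm n = 1 := by
  rw [lorentzForm, Matrix.diagonal_mul_diagonal, ← Matrix.diagonal_one]
  congr! 2 with i
  split_ifs <;> norm_num

namespace SUn1

variable {n : ℕ}

/-- The inclusion of `SU(n,1)` into the monoid of complex `(n+1) × (n+1)` matrices. -/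
def toMatrix : SUn1 n →* Matrix (Fin (n + 1)) (Fin (n + 1)) ℂ where
  toFun g := (g : Matrix.SpecialLinearGroup (Fin (n + 1)) ℂ)
  map_one' := rfl
  map_mul' _ _ := rfl

theorem continuous_toMatrix : Continuous (toMatrix (n := n)) :=
  continuous_subtype_val.comp continuous_subtype_val

theorem conjTranspose_mul_lorentzForm_mul (g : SUn1 n) :
    (toMatrix g)ᴴ * lorentzForm n * toMatrix g = lorentzForm n :=
  g.2

theorem toMatrix_inv (g : SUn1 n) :
    toMatrix g⁻¹ = lorentzForm n * (toMatrix g)ᴴ * lorentzForm n := by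
  have hleft : lorentzForm n * (toMatrix g)ᴴ * lorentzForm n * toMatrix g = 1 := by
    rw [Matrix.mul_assoc, Matrix.mul_assoc, ← Matrix.mul_assoc (toMatrix g)ᴴ,
      conjTranspose_mul_lorentzForm_mul, lorentzForm_mul_self]
  have hright : toMatrix g * toMatrix g⁻¹ = 1 := by
    rw [← map_mul, mul_inv_cancel, map_one]
  exact (left_inv_eq_right_inv hleft hright).symm

theorem trace_toMatrix_inv (g : SUn1 n) : (toMatrix g⁻¹).trace = star (toMatrix g).trace := by
  rw [toMatrix_inv, Matrix.trace_mul_comm, ← Matrix.mul_assoc, lorentzForm_mul_self,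
    Matrix.one_mul, Matrix.trace_conjTranspose]

theorem im_trace_toMatrix_eq_zero_of_isConj_inv {g : SUn1 n} (hg : IsConj g g⁻¹) :
    (toMatrix g).trace.im = 0 := by
  rw [← Complex.conj_eq_iff_im, ← Complex.star_def, ← trace_toMatrix_inv]
  exact (trace_eq_of_isConj (toMatrix.map_isConj hg)).symm

theorem normSq_toMatrix_zero_zero (g : SUn1 n) :
    Complex.normSq (toMatrix g 0 0) = 1 + ∑ i : Fin n, Complex.normSq (toMatrix g i.succ 0) := by
  have h := congrFun₂ (conjTranspose_mul_lorentzForm_mul g) 0 0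
  rw [lorentzForm, Matrix.mul_apply, Fin.sum_univ_succ] at h
  simp only [Matrix.mul_diagonal, Matrix.conjTranspose_apply, Matrix.diagonal_apply_eq,
    Fin.succ_ne_zero, if_true, if_false, mul_neg, mul_one, neg_mul, Complex.star_def,
    ← Complex.normSq_eq_conj_mul_self] at h
  have h' : -Complex.normSq (toMatrix g 0 0) +
    ∑ i : Fin n, Complex.normSq (toMatrix g i.succ 0) = -1 := by exact_mod_cast h
  linarith

theorem toMatrix_zero_zero_ne_zero (g : SUn1 n) : toMatrix g 0 0 ≠ 0 := by
  rw [← Complex.normSq_pos, normSq_toMatrix_zero_zero]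
  have : 0 ≤ ∑ i : Fin n, Complex.normSq (toMatrix g i.succ 0) :=
    Finset.sum_nonneg fun _ _ => Complex.normSq_nonneg _
  positivity

/-- The diagonal torus of `SU(n,1)`: the unimodular diagonal matrices of determinant one. -/
noncomputable def diagonal (d : Fin (n + 1) → Circle) (hd : ∏ i, d i = 1) : SUn1 n :=
  ⟨⟨Matrix.diagonal fun i => (d i : ℂ), by
    rw [Matrix.det_diagonal]
    exact (map_prod Circle.coeHom d _).symm.trans (congrArg _ hd)⟩, by
    change (Matrix.diagonal _)ᴴ * lorentzForm n * Matrix.diagonal _ = lorentzForm n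
    rw [lorentzForm, Matrix.diagonal_conjTranspose, Matrix.diagonal_mul_diagonal,
      Matrix.diagonal_mul_diagonal]
    congr! 2 with i
    rw [mul_right_comm, Pi.star_apply, Complex.star_def, ← Circle.coe_inv_eq_conj,
      ← Circle.coe_mul, inv_mul_cancel, Circle.coe_one, one_mul]⟩

theorem trace_toMatrix_diagonal_mul (d : Fin (n + 1) → Circle) (hd : ∏ i, d i = 1)
    (g : SUn1 n) : (toMatrix (diagonal d hd * g)).trace = ∑ i, (d i : ℂ) * toMatrix g i i := by
  have hdiag : toMatrix (diagonal d hd) = Matrix.diagonal fun i => (d i : ℂ) := rfl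
  simp only [map_mul, hdiag, Matrix.trace, Matrix.diag_apply, Matrix.diagonal_mul]

/-- The one-parameter group of matrices `diag(zⁿ, z⁻¹, …, z⁻¹)` with `|z| = 1`. It is the centre of
the stabilizer `S(U(1) × U(n))` of the negative line spanned by the first basis vector. -/
noncomputable def rotation (z : Circle) : SUn1 n :=
  diagonal (Fin.cons (z ^ n) fun _ => z⁻¹) (by simp [Fin.prod_univ_succ])

theorem continuous_rotation : Continuous (rotation (n := n)) := by
  refine ((Continuous.matrix_diagonal (continuous_pi fun i => ?_)).subtype_mk _).subtype_mk _
  cases i using Fin.cases <;> simp only [Fin.cons_zero, Fin.cons_succ] <;> fun_prop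

open Polynomial ComplexConjugate

theorem trace_toMatrix_rotation_mul (z : Circle) (g : SUn1 n) :
    (toMatrix (rotation z * g)).trace =
      z ^ n * toMatrix g 0 0 + conj (z : ℂ) * ∑ i : Fin n, toMatrix g i.succ i.succ := by
  rw [rotation, trace_toMatrix_diagonal_mul, Fin.sum_univ_succ, Finset.mul_sum]
  simp only [Fin.cons_zero, Fin.cons_succ, Circle.coe_pow, Circle.coe_inv_eq_conj]

/-- Replacing `z̄ b` by its negated conjugate leaves the imaginary part of the trace
`zⁿ a + z̄ b` unchanged and turns it into a polynomial in `z`, of degree `n` because `1 < n`. -/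
theorem countable_setOf_im_trace_toMatrix_rotation_mul_eq_zero (hn : 2 ≤ n) (g : SUn1 n) :
    {t : ℝ | (toMatrix (rotation (Circle.exp t) * g)).trace.im = 0}.Countable := by
  let p (a b : ℂ) : ℂ[X] := C a * X ^ n - C (conj b) * X
  have natDegree_p {a : ℂ} (ha : a ≠ 0) (b : ℂ) : (p a b).natDegree ≠ 0 := by
    have hcoeff : (p a b).coeff n = a := by simp [p, coeff_X, show 1 ≠ n by omega]
    have := le_natDegree_of_ne_zero (hcoeff.trans_ne ha)
    omega
  have im_eval_p (a b z : ℂ) : ((p a b).eval z).im = (z ^ n * a + conj z * b).im := by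
    simp only [p, eval_sub, eval_mul, eval_C, eval_pow, eval_X, Complex.sub_im, Complex.mul_im,
      Complex.conj_re, Complex.conj_im, Complex.add_im]
    ring
  have hfinite := finite_setOf_norm_eq_one_and_im_eval_eq_zero
    (natDegree_p (toMatrix_zero_zero_ne_zero g) (∑ i : Fin n, toMatrix g i.succ i.succ))
  refine (hfinite.countable.preimage_circleMap 0 one_ne_zero).mono fun t ht => ?_
  have hexp : circleMap 0 1 t = Circle.exp t := by simp [circleMap_zero]
  rw [Set.mem_ofPred_eq, trace_toMatrix_rotation_mul] at ht
  rw [Set.mem_preimage, hexp]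
  exact ⟨Circle.norm_coe _, (im_eval_p ..).trans ht⟩

end SUn1

theorem mainTheorem10_general {n : ℕ} (hn : 2 ≤ n) (μ : Measure (SUn1 n × SUn1 n))
    [μ.IsMulLeftInvariant] [SFinite μ] :
    μ {p : SUn1 n × SUn1 n | IsConj p.1 p.1⁻¹} = 0 := by
  have hclosed : IsClosed {p : SUn1 n × SUn1 n | (SUn1.toMatrix p.1).trace.im = 0} :=
    isClosed_eq (Complex.continuous_im.comp
      (SUn1.continuous_toMatrix.comp continuous_fst).matrix_trace) continuous_const
  have hu : Continuous fun t : ℝ => ((SUn1.rotation (Circle.exp t), 1) : SUn1 n × SUn1 n) :=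
    (SUn1.continuous_rotation.comp Circle.exp.continuous).prodMk continuous_const
  refine measure_mono_null (fun p hp => SUn1.im_trace_toMatrix_eq_zero_of_isConj_inv hp) ?_
  exact measure_eq_zero_of_forall_measure_smul_mem_eq_zero μ volume hu.measurable
    hclosed.measurableSet fun p =>
      (SUn1.countable_setOf_im_trace_toMatrix_rotation_mul_eq_zero hn p.1).measure_zero _

theorem mainTheorem10 (n : ℕ) (hn : 2 ≤ n)
    (μ : Measure (SUn1 n × SUn1 n)) [μ.IsHaarMeasure] :
    μ {p : SUn1 n × SUn1 n | StronglyDoublyReversible p.1 p.2} = 0 :=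
  measure_mono_null (fun _ ⟨h, _, h₁, _⟩ => isConj_iff.mpr ⟨h, h₁⟩) (mainTheorem10_general hn μ)
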